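/- Let $K$ be an infinite field, let $1\le a<b$ be integers, let $N\ge a$ be an integer, and let $R=K[x_0,\dots,x_N]$ be the homogeneous coordinate ring of $\mathbb{P}^N=\mathbb{P}^N_K$. For a linear subspace $L\subset\mathbb{P}^N$ let $I(L)\subset R$ be the ideal generated by the linear forms vanishing on $L$. A fat flat subscheme $W=\sum_{i=1}^t m_iL_i$ of $\mathbb{P}^N$ ($t\ge 1$, $m_i\ge 1$) is given by nonempty proper linear subspaces $L_i$, none of which contains another, and has the ideal $I(W)=\bigcap_i I(L_i)^{m_i}$. For a homogeneous ideal $I\ne 0$ let $\alpha(I)$ be the least degree of a nonzero homogeneous element of $I$, let $I^{(k)}=\bigcap_{P\in\mathrm{Ass}(R/I)}(I^kR_P\cap R)$, and let $\widehat\alpha(I)=\lim_{k\to\infty}\alpha(I^{(k)})/k$ be the Waldschmidt constant. Hyperplanes $H_1,\dots,H_s$ in $\mathbb{P}^N$ are in general position if any $j\le N+1$ of them meet in codimension exactly $j$ (for $j=N+1$: have empty intersection). For $1\le e\le\min(s,N)$ the star configuration $S_N(e,s)$ of such hyperplanes is the sum, with all multiplicities $1$, of the $\binom{s}{e}$ linear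 subspaces obtained by intersecting $e$ of them. For $m\ge 1$, a scheme of the form $W'+mS_N(e,s)$ is one where $W'=\sum_r m_rM_r$ is a finite (possibly empty) sum of distinct linear subspaces $M_r$ of codimensions between $2$ and $N$, each contained in $\bigcup_j H_j$ and none a member of $S_N(e,s)$, with $1\le m_r\le\lfloor m/e\rfloor$, such that no linear subspace occurring in $W'+mS_N(e,s)$ contains another one. Then there is a fat flat subscheme $W$ of $\mathbb{P}^N$ with $\widehat\alpha(I(W))=b/a$. More precisely: (1) for all positive integers $s,m$ with $b=sm$ and $s\ge a$, schemes of the form $W=W'+mS_N(a,s)$ exist, and every such $W$ (for any hyperplanes $H_1,\dots,H_s$ in general position) is a fat flat subscheme with $\widehat\alpha(I(W))=b/a$; (2) star configurations $W=S_N(a,b)$ exist in $\mathbb{P}^N$, and each of them (for any $b$ hyperplanes in general position) is a fat flat subscheme with $\widehat\alpha(I(W))=b/a$. -/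

import Mathlib

open Filter Topology

noncomputable section

namespace FatFlats

/-- Homogeneous coordinate ring `K[x_0, ..., x_N]` of `ℙ^N`. -/
abbrev CoordRing (K : Type*) [Field K] (N : ℕ) : Type _ := MvPolynomial (Fin (N + 1)) K

/-- Linear subspaces of `ℙ^N`, represented by their cones in `K^(N+1)`. The subspace has
codimension `i` in `ℙ^N` when its cone has dimension `N + 1 - i`; the zero cone is the empty set. -/
abbrev Flat (K : Type*) [Field K] (N : ℕ) : Type _ := Submodule K (Fin (N + 1) → K)

/-- The homogeneous ideal `I(L)` of a linear subspace `L`: it is generated by the linear forms that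
vanish on `L`. -/
def flatIdeal {K : Type*} [Field K] {N : ℕ} (L : Flat K N) : Ideal (CoordRing K N) :=
  Ideal.span {f | f.IsHomogeneous 1 ∧ ∀ v ∈ L, MvPolynomial.eval v f = 0}

/-- A finite formal sum `∑ m_i L_i` of linear subspaces with multiplicities `m_i ∈ ℕ`; terms of
multiplicity zero are not recorded. -/
abbrev FlatSum (K : Type*) [Field K] (N : ℕ) : Type _ := Flat K N →₀ ℕ

/-- The ideal `I(W) = ⋂ I(L_i) ^ m_i` of the formal sum `W = ∑ m_i L_i`. -/
def fatIdeal {K : Type*} [Field K] {N : ℕ} (W : FlatSum K N) : Ideal (CoordRing K N) :=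
  ⨅ L ∈ W.support, flatIdeal L ^ W L

/-- `W = ∑ m_i L_i` is a fat flat subscheme: there is at least one `L_i`, each `L_i` is a nonempty
proper linear subspace of `ℙ^N`, and none of the `L_i` contains another one. (The multiplicities
on the support are automatically at least `1`.) -/
structure IsFatFlat {K : Type*} [Field K] {N : ℕ} (W : FlatSum K N) : Prop where
  nonempty : W.support.Nonempty
  proper : ∀ L ∈ W.support, L ≠ ⊥ ∧ L ≠ ⊤
  antichain : IsAntichain (· ≤ ·) (W.support : Set (Flat K N))

/-- The `k`-th symbolic power `I^(k)`: the intersection over `P ∈ Ass(R/I)` of the contractions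
to `R` of `I^k R_P`. -/
def symbolicPower {R : Type*} [CommRing R] (I : Ideal R) (k : ℕ) : Ideal R :=
  ⨅ (P : PrimeSpectrum R) (_ : P.asIdeal ∈ associatedPrimes R (R ⧸ I)),
    ((I ^ k).map (algebraMap R (Localization.AtPrime P.asIdeal))).comap
      (algebraMap R (Localization.AtPrime P.asIdeal))

/-- `α(I)`: the least degree of a nonzero homogeneous element of `I`. -/
def initialDegree {K : Type*} [Field K] {N : ℕ} (I : Ideal (CoordRing K N)) : ℕ :=
  sInf {t : ℕ | ∃ f ∈ I, f ≠ 0 ∧ f.IsHomogeneous t}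

/-- The Waldschmidt constant of `I`, the limit of `α(I^(k)) / k`, exists and equals `c`. -/
def HasWaldschmidtConstant {K : Type*} [Field K] {N : ℕ} (I : Ideal (CoordRing K N)) (c : ℝ) :
    Prop :=
  Tendsto (fun k : ℕ => (initialDegree (symbolicPower I k) : ℝ) / k) atTop (𝓝 c)

/-- `H_1, ..., H_s` are hyperplanes of `ℙ^N` in general position: any `j ≤ N + 1` of them meet in
codimension exactly `j` (the case `j = 1` says that they are hyperplanes). -/
def InGeneralPosition {K : Type*} [Field K] {N s : ℕ} (H : Fin s → Flat K N) : Prop :=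
  ∀ J : Finset (Fin s), J.card ≤ N + 1 → Module.finrank K ↥(J.inf H) + J.card = N + 1

/-- The star configuration `S_N(e,s)` of the hyperplanes `H_1, ..., H_s`: the sum, with
multiplicity one, of all intersections of `e` of these hyperplanes. -/
def star {K : Type*} [Field K] {N s : ℕ} (H : Fin s → Flat K N) (e : ℕ) : FlatSum K N :=
  ∑ J ∈ (Finset.univ : Finset (Fin s)).powersetCard e, Finsupp.single (J.inf H) 1

/-- `W'` may be added to `m S_N(e,s)`: it is a finite sum of linear subspaces `M` of codimensions
between `2` and `N`, contained in the union of the hyperplanes, different from the members of the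
star configuration, with multiplicities at most `⌊m/e⌋`, such that no linear subspace occurring in
`W' + m S_N(e,s)` contains another one. -/
structure IsAdmissible {K : Type*} [Field K] {N s : ℕ} (H : Fin s → Flat K N) (e m : ℕ)
    (W' : FlatSum K N) : Prop where
  codim : ∀ M ∈ W'.support, ∃ i, 2 ≤ i ∧ i ≤ N ∧ Module.finrank K ↥M + i = N + 1
  subset_union : ∀ M ∈ W'.support, (M : Set (Fin (N + 1) → K)) ⊆ ⋃ j, (H j : Set (Fin (N + 1) → K))
  disjoint_star : Disjoint W'.support (star H e).support
  mult_le : ∀ M, W' M ≤ m / e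
  antichain : IsAntichain (· ≤ ·) ((W' + m • star H e).support : Set (Flat K N))

end FatFlats

end

/-! Powers of the prime I(L) of a linear subspace are primary, so for an antichain of flats I(W)^(k)
is the intersection of the I(L)^(k W(L)) (`IsFatFlat.mem_symbolicPower_iff`), and α(I(W)^(k)) is
governed by orders of vanishing along flats. Write e for the codimension of the star configuration.

Upper bound: the product of the s hyperplane equations, raised to about mk/e, has order at least mk
along every e-fold intersection. Each flat of W' lies in a single hyperplane, K being infinite, and
its multiplicity is at most ⌊m/e⌋, so W' costs nothing.

Lower bound (`sum_order_le`): if f ≠ 0 of degree at most d has order at least n_J along the flat of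
each e-subset J, then ∑ n_J ≤ d·C(s-1, e-1). A hyperplane equation contributes exactly C(s-1, e-1)
to the sum, so such factors can be divided out; varying n_J are needed because division lowers only
the orders with j ∈ J. Once no H_j divides f, restrict f to each H_j, induct on e, and average over
j. With n_J = mk this gives α ≥ smk/e, and the two bounds squeeze α/k to sm/e. -/

noncomputable section

namespace FatFlats

/-! ### Linear forms, ideals of flats, and restriction along linear maps. -/

section Restriction

variable {K : Type*} [Field K] {M N : ℕ}

/-- The linear form attached to a functional on `K^(N+1)`, as a polynomial. -/
def linForm : Module.Dual K (Fin (N + 1) → K) →ₗ[K] CoordRing K N where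
  toFun ψ := ∑ i, ψ (Pi.single i 1) • MvPolynomial.X i
  map_add' ψ χ := by simp [add_smul, Finset.sum_add_distrib]
  map_smul' c ψ := by simp [mul_smul, Finset.smul_sum]

theorem linForm_apply (ψ : Module.Dual K (Fin (N + 1) → K)) :
    linForm ψ = ∑ i, ψ (Pi.single i 1) • (MvPolynomial.X i : CoordRing K N) := rfl

theorem functional_eq_sum (ψ : Module.Dual K (Fin (N + 1) → K)) :
    ψ = ∑ i, ψ (Pi.single i 1) • LinearMap.proj i := by
  refine LinearMap.pi_ext' fun i => LinearMap.ext_ring ?_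
  simp [Pi.single_apply]

@[simp] theorem linForm_proj (i : Fin (N + 1)) :
    linForm (LinearMap.proj i) = (MvPolynomial.X i : CoordRing K N) := by
  simp [linForm_apply, Pi.single_apply]

@[simp] theorem eval_linForm (ψ : Module.Dual K (Fin (N + 1) → K)) (v : Fin (N + 1) → K) :
    MvPolynomial.eval v (linForm ψ) = ψ v := by
  conv_rhs => rw [functional_eq_sum ψ]
  simp [linForm_apply, MvPolynomial.smul_eval]

theorem isHomogeneous_linForm (ψ : Module.Dual K (Fin (N + 1) → K)) :
    (linForm ψ).IsHomogeneous 1 := by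
  refine MvPolynomial.IsHomogeneous.sum _ _ _ fun i _ => ?_
  rw [MvPolynomial.smul_eq_C_mul]
  exact MvPolynomial.isHomogeneous_C_mul_X _ _

theorem linForm_injective :
    Function.Injective (linForm : Module.Dual K (Fin (N + 1) → K) →ₗ[K] CoordRing K N) :=
  fun ψ χ h => LinearMap.ext fun v => by simpa using congrArg (MvPolynomial.eval v) h

theorem exists_linForm_eq {f : CoordRing K N} (hf : f.IsHomogeneous 1) :
    ∃ ψ, linForm ψ = f := by
  have h : f ∈ MvPolynomial.homogeneousSubmodule (Fin (N + 1)) K 1 := hf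
  rw [MvPolynomial.homogeneousSubmodule_one_eq_span_X] at h
  have hle : Submodule.span K (Set.range (MvPolynomial.X : Fin (N + 1) → CoordRing K N)) ≤
      LinearMap.range linForm :=
    Submodule.span_le.2 (Set.range_subset_iff.2 fun i => ⟨_, linForm_proj i⟩)
  exact hle h

/-- An algebra map that agrees with a linear map on the variables does so on linear forms. -/
theorem map_linForm {S : Type*} [CommRing S] [Algebra K S] (φ : CoordRing K N →ₐ[K] S)
    (g : Module.Dual K (Fin (N + 1) → K) →ₗ[K] S)
    (h : ∀ i, φ (MvPolynomial.X i) = g (LinearMap.proj i))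
    (ψ : Module.Dual K (Fin (N + 1) → K)) : φ (linForm ψ) = g ψ := by
  conv_rhs => rw [functional_eq_sum ψ]
  simp [linForm_apply, h]

/-- Restriction of polynomials along a linear map. -/
def pullback (A : (Fin (M + 1) → K) →ₗ[K] (Fin (N + 1) → K)) :
    CoordRing K N →ₐ[K] CoordRing K M :=
  MvPolynomial.aeval fun i => linForm (LinearMap.proj i ∘ₗ A)

@[simp] theorem pullback_linForm (A : (Fin (M + 1) → K) →ₗ[K] (Fin (N + 1) → K))
    (ψ : Module.Dual K (Fin (N + 1) → K)) : pullback A (linForm ψ) = linForm (ψ ∘ₗ A) :=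
  map_linForm (pullback A) (linForm ∘ₗ A.dualMap) (fun i => by simp [pullback]; rfl) ψ

/-- The lower bound works with total degree at most d, which survives restriction without tracking
homogeneity. -/
theorem totalDegree_pullback_le (A : (Fin (M + 1) → K) →ₗ[K] (Fin (N + 1) → K))
    (f : CoordRing K N) : (pullback A f).totalDegree ≤ f.totalDegree := by
  rw [pullback, MvPolynomial.aeval_def, MvPolynomial.eval₂_eq]
  refine MvPolynomial.totalDegree_finsetSum_le fun d hd => ?_
  refine (MvPolynomial.totalDegree_mul _ _).trans ?_
  rw [MvPolynomial.algebraMap_eq, MvPolynomial.totalDegree_C, zero_add]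
  refine (MvPolynomial.totalDegree_finsetProd _ _).trans ?_
  refine le_trans (Finset.sum_le_sum fun i _ => ?_) (MvPolynomial.le_totalDegree hd)
  refine (MvPolynomial.totalDegree_pow _ _).trans ?_
  simpa using Nat.mul_le_mul_left (d i) (isHomogeneous_linForm _).totalDegree_le

theorem linForm_mem_flatIdeal {L : Flat K N} {ψ : Module.Dual K (Fin (N + 1) → K)}
    (h : ∀ v ∈ L, ψ v = 0) : linForm ψ ∈ flatIdeal L :=
  Ideal.subset_span ⟨isHomogeneous_linForm ψ, by simpa using h⟩

theorem flatIdeal_le_iff {L : Flat K N} {I : Ideal (CoordRing K N)} :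
    flatIdeal L ≤ I ↔
      ∀ ψ : Module.Dual K (Fin (N + 1) → K), (∀ v ∈ L, ψ v = 0) → linForm ψ ∈ I := by
  refine ⟨fun h ψ hψ => h (linForm_mem_flatIdeal hψ), fun h => Ideal.span_le.2 ?_⟩
  rintro f ⟨hf, hL⟩
  obtain ⟨ψ, rfl⟩ := exists_linForm_eq hf
  exact h ψ (by simpa using hL)

theorem eval_eq_zero_of_mem_flatIdeal {L : Flat K N} {f : CoordRing K N} (hf : f ∈ flatIdeal L)
    {v : Fin (N + 1) → K} (hv : v ∈ L) : MvPolynomial.eval v f = 0 := by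
  have : flatIdeal L ≤ RingHom.ker (MvPolynomial.eval v) :=
    flatIdeal_le_iff.2 fun ψ hψ => by simpa using hψ v hv
  exact this hf

theorem pullback_mem_pow {L : Flat K N} {n : ℕ} {f : CoordRing K N} (hf : f ∈ flatIdeal L ^ n)
    (A : (Fin (M + 1) → K) →ₗ[K] (Fin (N + 1) → K)) :
    pullback A f ∈ flatIdeal (L.comap A) ^ n := by
  have h : (flatIdeal L).map (pullback A) ≤ flatIdeal (L.comap A) :=
    Ideal.map_le_iff_le_comap.2 <| flatIdeal_le_iff.2 fun ψ hψ => by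
      rw [Ideal.mem_comap, pullback_linForm]
      exact linForm_mem_flatIdeal fun v hv => hψ _ hv
  have := Ideal.mem_map_of_mem (pullback A) hf
  rw [Ideal.map_pow] at this
  exact Ideal.pow_right_mono h n this

end Restriction

/-! ### Order of vanishing along a flat. -/

section Order

open Polynomial

variable {K : Type*} [Field K] {N : ℕ}

theorem exists_projOnto (L : Flat K N) :
    ∃ π : (Fin (N + 1) → K) →ₗ[K] (Fin (N + 1) → K), (∀ v, π v ∈ L) ∧ ∀ v ∈ L, π v = v := by
  obtain ⟨g, hg⟩ := L.subtype.exists_leftInverse_of_injective L.ker_subtype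
  exact ⟨L.subtype ∘ₗ g, fun v => (g v).2, fun v hv => congrArg Subtype.val
    (LinearMap.congr_fun hg ⟨v, hv⟩)⟩

/-- A linear projection of `K^(N+1)` onto a subspace. -/
def projOnto (L : Flat K N) : (Fin (N + 1) → K) →ₗ[K] (Fin (N + 1) → K) :=
  (exists_projOnto L).choose

theorem projOnto_mem (L : Flat K N) (v : Fin (N + 1) → K) : projOnto L v ∈ L :=
  (exists_projOnto L).choose_spec.1 v

theorem projOnto_eq {L : Flat K N} {v : Fin (N + 1) → K} (hv : v ∈ L) : projOnto L v = v :=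
  (exists_projOnto L).choose_spec.2 v hv

/-- The linear data of `reesMap`. -/
def reesLin (L : Flat K N) : Module.Dual K (Fin (N + 1) → K) →ₗ[K] (CoordRing K N)[X] where
  toFun ψ := C (linForm (ψ ∘ₗ projOnto L)) + X * C (linForm (ψ - ψ ∘ₗ projOnto L))
  map_add' ψ χ := by simp [LinearMap.add_comp]; ring
  map_smul' c ψ := by
    simp only [LinearMap.smul_comp, ← smul_sub, map_smul, ← Polynomial.smul_C, RingHom.id_apply,
      smul_add, mul_smul_comm]

/-- The substitution `x ↦ π x + T (x - π x)`, where `π` is a projection onto `L`. The order of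
vanishing along `L` is the order in `T` of its values. -/
def reesMap (L : Flat K N) : CoordRing K N →ₐ[K] (CoordRing K N)[X] :=
  MvPolynomial.aeval fun i => reesLin L (LinearMap.proj i)

theorem reesMap_linForm (L : Flat K N) (ψ : Module.Dual K (Fin (N + 1) → K)) :
    reesMap L (linForm ψ) =
      C (linForm (ψ ∘ₗ projOnto L)) + X * C (linForm (ψ - ψ ∘ₗ projOnto L)) :=
  map_linForm (reesMap L) (reesLin L) (fun i => MvPolynomial.aeval_X _ i) ψ

theorem reesMap_linForm_of_vanishes {L : Flat K N} {ψ : Module.Dual K (Fin (N + 1) → K)}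
    (hψ : ∀ v ∈ L, ψ v = 0) : reesMap L (linForm ψ) = X * C (linForm ψ) := by
  have : ψ ∘ₗ projOnto L = 0 := LinearMap.ext fun v => hψ _ (projOnto_mem L v)
  rw [reesMap_linForm, this]
  simp

theorem eval_one_reesMap (L : Flat K N) (f : CoordRing K N) : (reesMap L f).eval 1 = f := by
  have : ((Polynomial.aeval (1 : CoordRing K N)).restrictScalars K).comp (reesMap L) =
      AlgHom.id K _ := by
    refine MvPolynomial.algHom_ext fun i => ?_
    simp only [AlgHom.comp_apply, ← linForm_proj, reesMap_linForm]
    simp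
  simpa [Polynomial.aeval_def] using AlgHom.congr_fun this f

/-- The form x - πx multiplying T vanishes on L, so the coefficient of T^i lies in I(L)^i. Setting T
= 1 then recovers f from these coefficients. -/
theorem reesMap_mem_reesAlgebra (L : Flat K N) (f : CoordRing K N) :
    reesMap L f ∈ reesAlgebra (flatIdeal L) := by
  induction f using MvPolynomial.induction_on with
  | C a =>
    rw [← MvPolynomial.algebraMap_eq, AlgHom.commutes]
    exact (reesAlgebra (flatIdeal L)).algebraMap_mem (algebraMap K (CoordRing K N) a)
  | add p q hp hq => rw [map_add]; exact add_mem hp hq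
  | mul_X p i hp =>
    rw [map_mul]
    refine mul_mem hp ?_
    rw [← linForm_proj, reesMap_linForm]
    refine add_mem ((reesAlgebra (flatIdeal L)).algebraMap_mem _) ?_
    rw [mul_comm, ← pow_one (X : (CoordRing K N)[X]), C_mul_X_pow_eq_monomial]
    refine reesAlgebra.monomial_mem.2 ?_
    rw [pow_one]
    refine linForm_mem_flatIdeal fun v hv => ?_
    simp [projOnto_eq hv]

/-- Membership in the powers of the ideal of a linear subspace is a condition on the order in `T`
after the substitution `reesMap`. -/
theorem mem_flatIdeal_pow_iff {L : Flat K N} {n : ℕ} {f : CoordRing K N} :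
    f ∈ flatIdeal L ^ n ↔ X ^ n ∣ reesMap L f := by
  constructor
  · intro hf
    have h : (flatIdeal L).map (reesMap L) ≤ Ideal.span {X} :=
      Ideal.map_le_iff_le_comap.2 <| flatIdeal_le_iff.2 fun ψ hψ => by
        rw [Ideal.mem_comap, reesMap_linForm_of_vanishes hψ]
        exact Ideal.mem_span_singleton.2 (dvd_mul_right _ _)
    have := Ideal.mem_map_of_mem (reesMap L) hf
    rw [Ideal.map_pow] at this
    have := Ideal.pow_right_mono h n this
    rwa [Ideal.span_singleton_pow, Ideal.mem_span_singleton] at this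
  · intro h
    rw [← eval_one_reesMap L f, Polynomial.eval_eq_sum]
    refine Ideal.sum_mem _ fun i hi => ?_
    simp only [one_pow, mul_one]
    have hi' : n ≤ i := by
      by_contra! hlt
      exact (mem_support_iff.1 hi) (X_pow_dvd_iff.1 h i hlt)
    exact Ideal.pow_le_pow_right hi' (reesMap_mem_reesAlgebra L f i)

theorem mem_flatIdeal_iff {L : Flat K N} {f : CoordRing K N} :
    f ∈ flatIdeal L ↔ X ∣ reesMap L f := by
  simpa using mem_flatIdeal_pow_iff (L := L) (n := 1) (f := f)

theorem linForm_mem_flatIdeal_iff {L : Flat K N} {ψ : Module.Dual K (Fin (N + 1) → K)} :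
    linForm ψ ∈ flatIdeal L ↔ ∀ v ∈ L, ψ v = 0 :=
  ⟨fun h v hv => by simpa using eval_eq_zero_of_mem_flatIdeal h hv, linForm_mem_flatIdeal⟩

/-- I(L) is the preimage of the prime ideal (T) under `reesMap L`. -/
instance isPrime_flatIdeal (L : Flat K N) : (flatIdeal L).IsPrime := by
  refine ⟨fun h => ?_, fun {f g} hfg => ?_⟩
  · have := eval_eq_zero_of_mem_flatIdeal ((Ideal.eq_top_iff_one _).1 h) L.zero_mem
    simp at this
  · rw [mem_flatIdeal_iff, map_mul] at hfg
    simpa only [mem_flatIdeal_iff] using prime_X.dvd_or_dvd hfg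

/-- The powers of the ideal of a linear subspace are primary. -/
theorem mem_pow_of_mul_mem_pow {L : Flat K N} {n : ℕ} {f g : CoordRing K N}
    (h : f * g ∈ flatIdeal L ^ n) (hf : f ∉ flatIdeal L) : g ∈ flatIdeal L ^ n := by
  rw [mem_flatIdeal_pow_iff, map_mul] at h
  rw [mem_flatIdeal_iff] at hf
  exact mem_flatIdeal_pow_iff.2 (prime_X.pow_dvd_of_dvd_mul_left n hf h)

/-- A nonzero linear form vanishing on `L` vanishes to order exactly one. -/
theorem mem_pow_of_linForm_mul_mem_pow {L : Flat K N} {n : ℕ} {g : CoordRing K N}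
    {ψ : Module.Dual K (Fin (N + 1) → K)} (hψ : ψ ≠ 0) (hL : ∀ v ∈ L, ψ v = 0)
    (h : linForm ψ * g ∈ flatIdeal L ^ (n + 1)) : g ∈ flatIdeal L ^ n := by
  rw [mem_flatIdeal_pow_iff, map_mul, reesMap_linForm_of_vanishes hL, pow_succ', mul_assoc] at h
  have h' := (mul_dvd_mul_iff_left (X_ne_zero (R := CoordRing K N))).1 h
  refine mem_flatIdeal_pow_iff.2 (prime_X.pow_dvd_of_dvd_mul_left n (fun hd => hψ ?_) h')
  have := X_dvd_iff.1 hd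
  rw [coeff_C_zero] at this
  exact linForm_injective (by rw [this, map_zero])

theorem linForm_pow_notMem {L : Flat K N} {ψ : Module.Dual K (Fin (N + 1) → K)} (hψ : ψ ≠ 0)
    (hL : ∀ v ∈ L, ψ v = 0) (n : ℕ) : linForm ψ ^ n ∉ flatIdeal L ^ (n + 1) := by
  induction n with
  | zero =>
    rw [pow_zero, zero_add, pow_one]
    exact fun h => (isPrime_flatIdeal L).ne_top ((Ideal.eq_top_iff_one _).2 h)
  | succ n ih =>
    rw [pow_succ' (linForm ψ)]
    exact fun h => ih (mem_pow_of_linForm_mul_mem_pow hψ hL h)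

/-- The ideal of `L` contains the polynomials that restrict to zero
along a parametrization of a subspace containing `L`. -/
theorem mem_flatIdeal_of_pullback_eq_zero {M : ℕ} {L : Flat K N}
    {A : (Fin (M + 1) → K) →ₗ[K] (Fin (N + 1) → K)} (hA : L ≤ LinearMap.range A)
    {f : CoordRing K N} (hf : pullback A f = 0) : f ∈ flatIdeal L := by
  obtain ⟨B, hB⟩ : ∃ B : (Fin (N + 1) → K) →ₗ[K] (Fin (M + 1) → K), A ∘ₗ B = projOnto L := by
    obtain ⟨g, hg⟩ := A.rangeRestrict.exists_rightInverse_of_surjective A.range_rangeRestrict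
    refine ⟨g ∘ₗ (projOnto L).codRestrict _ fun v => hA (projOnto_mem L v), ?_⟩
    ext1 i
    ext1
    exact congrArg Subtype.val (LinearMap.congr_fun hg _)
  -- At T = 0, `reesMap L` is restriction along the projection A ∘ B, so it factors through
  -- restriction along A.
  have h : (pullback B).comp (pullback A) =
      ((Polynomial.aeval (0 : CoordRing K N)).restrictScalars K).comp (reesMap L) := by
    refine MvPolynomial.algHom_ext fun i => ?_
    simp only [AlgHom.comp_apply, ← linForm_proj, reesMap_linForm, pullback_linForm,
      LinearMap.comp_assoc, hB]
    simp
  rw [mem_flatIdeal_iff, X_dvd_iff, coeff_zero_eq_eval_zero]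
  have := AlgHom.congr_fun h f
  rw [AlgHom.comp_apply, hf, map_zero] at this
  simpa [Polynomial.aeval_def] using this.symm

end Order

/-! ### Binomial double counting. -/

section Counting

variable {ι : Type*} [DecidableEq ι]

theorem sum_powersetCard_filter_mem {S : Finset ι} {j : ι} (hj : j ∈ S) (a : ℕ)
    (n : Finset ι → ℕ) :
    ∑ J ∈ S.powersetCard (a + 1) with j ∈ J, n J =
      ∑ J ∈ (S.erase j).powersetCard a, n (insert j J) := by
  refine Finset.sum_nbij' (fun J => J.erase j) (fun J => insert j J) ?_ ?_ ?_ ?_ ?_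
  · intro J hJ
    simp only [Finset.mem_filter, Finset.mem_powersetCard] at hJ ⊢
    exact ⟨Finset.erase_subset_erase j hJ.1.1, by rw [Finset.card_erase_of_mem hJ.2]; lia⟩
  · intro J hJ
    simp only [Finset.mem_filter, Finset.mem_powersetCard] at hJ ⊢
    have hjJ : j ∉ J := fun h => Finset.notMem_erase j S (hJ.1 h)
    exact ⟨⟨Finset.insert_subset hj (hJ.1.trans (Finset.erase_subset j S)), by
      rw [Finset.card_insert_of_notMem hjJ, hJ.2]⟩, Finset.mem_insert_self j J⟩
  · intro J hJ
    exact Finset.insert_erase (Finset.mem_filter.1 hJ).2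
  · intro J hJ
    exact Finset.erase_insert fun h =>
      Finset.notMem_erase j S ((Finset.mem_powersetCard.1 hJ).1 h)
  · intro J hJ
    rw [Finset.insert_erase (Finset.mem_filter.1 hJ).2]

theorem card_powersetCard_filter_mem {S : Finset ι} {j : ι} (hj : j ∈ S) (a : ℕ) :
    (S.powersetCard (a + 1) |>.filter (j ∈ ·)).card = (S.card - 1).choose a := by
  have := sum_powersetCard_filter_mem hj a fun _ => 1
  simpa [Finset.card_erase_of_mem hj] using this

theorem sum_sum_powersetCard_filter_mem (S : Finset ι) (a : ℕ) (n : Finset ι → ℕ) :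
    ∑ j ∈ S, ∑ J ∈ S.powersetCard a with j ∈ J, n J = a * ∑ J ∈ S.powersetCard a, n J := by
  simp_rw [Finset.sum_filter]
  rw [Finset.sum_comm, Finset.mul_sum]
  refine Finset.sum_congr rfl fun J hJ => ?_
  rw [Finset.mem_powersetCard] at hJ
  rw [← Finset.sum_filter, Finset.filter_mem_eq_inter, Finset.inter_eq_right.2 hJ.1,
    Finset.sum_const, hJ.2, smul_eq_mul]

/-- By the absorption identity this is (a+1)s ≤ (a+2)(s-1), that is, a + 2 ≤ s. It closes the
averaging step of `sum_order_le`. -/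
theorem mul_choose_le {s a : ℕ} (h : a + 2 ≤ s) :
    s * (s - 2).choose a ≤ (a + 2) * (s - 1).choose (a + 1) := by
  obtain ⟨t, rfl⟩ := Nat.exists_eq_add_of_le' (show 2 ≤ s by lia)
  have h1 : (t + 1) * t.choose a = (t + 1).choose (a + 1) * (a + 1) := Nat.add_one_mul_choose_eq t a
  simp only [Nat.add_sub_cancel, show t + 2 - 1 = t + 1 by lia]
  refine Nat.le_of_mul_le_mul_left ?_ (Nat.succ_pos a)
  calc (a + 1) * ((t + 2) * t.choose a) = ((a + 1) * (t + 2)) * t.choose a := by ring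
    _ ≤ ((a + 2) * (t + 1)) * t.choose a := Nat.mul_le_mul_right _ (by nlinarith)
    _ = (a + 2) * ((t + 1) * t.choose a) := by ring
    _ = (a + 1) * ((a + 2) * (t + 1).choose (a + 1)) := by rw [h1]; ring

end Counting

/-! ### Hyperplanes in general position and the degree bound. -/

section GeneralPosition

variable {K : Type*} [Field K] {N : ℕ} {ι : Type*}

/-- General position of the hyperplanes indexed by a finite set. -/
def InGeneralPositionOn (S : Finset ι) (H : ι → Flat K N) : Prop :=
  ∀ J ⊆ S, J.card ≤ N + 1 → Module.finrank K ↥(J.inf H) + J.card = N + 1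

variable {S : Finset ι} {H : ι → Flat K N}

theorem exists_functional (hH : InGeneralPositionOn S H) {j : ι} (hj : j ∈ S) :
    ∃ ψ : Module.Dual K (Fin (N + 1) → K), ψ ≠ 0 ∧ H j = LinearMap.ker ψ := by
  have h1 := hH {j} (by simpa using hj) (by simp)
  rw [Finset.inf_singleton, Finset.card_singleton] at h1
  have hlt : H j < ⊤ := by
    refine lt_top_iff_ne_top.2 fun h => ?_
    rw [h, finrank_top, Module.finrank_fin_fun] at h1
    lia
  obtain ⟨ψ, hψ, hle⟩ := Submodule.exists_le_ker_of_lt_top _ hlt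
  refine ⟨ψ, hψ, Submodule.eq_of_le_of_finrank_eq hle ?_⟩
  have h2 := Module.Dual.finrank_ker_add_one_of_ne_zero hψ
  rw [Module.finrank_fin_fun] at h2
  lia

/-- Functionals vanishing on ker ψ are multiples of ψ, so the ideal of a hyperplane is principal. -/
theorem exists_mul_eq_of_mem_flatIdeal_ker {ψ : Module.Dual K (Fin (N + 1) → K)}
    {f : CoordRing K N} (hf : f ∈ flatIdeal (LinearMap.ker ψ)) : ∃ g, f = linForm ψ * g := by
  have h : flatIdeal (LinearMap.ker ψ) ≤ Ideal.span {linForm ψ} := by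
    refine flatIdeal_le_iff.2 fun χ hχ => ?_
    have hmem : χ ∈ Submodule.span K (Set.range fun _ : Unit => ψ) :=
      mem_span_of_iInf_ker_le_ker (by rw [iInf_const]; exact hχ)
    rw [Set.range_const, Submodule.mem_span_singleton] at hmem
    obtain ⟨c, rfl⟩ := hmem
    rw [map_smul, MvPolynomial.smul_eq_C_mul]
    exact Ideal.mul_mem_left _ _ (Ideal.mem_span_singleton_self _)
  exact Ideal.mem_span_singleton'.1 (h hf) |>.imp fun g hg => by rw [← hg, mul_comm]

/-- Otherwise intersecting with one more hyperplane would not lower the dimension. At N + 1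
hyperplanes the intersection is zero and lies in everything, hence the bound N. -/
theorem not_inf_le [DecidableEq ι] (hH : InGeneralPositionOn S H) {J : Finset ι} (hJ : J ⊆ S)
    (hcard : J.card ≤ N) {j : ι} (hj : j ∈ S) (hjJ : j ∉ J) : ¬ J.inf H ≤ H j := by
  intro hle
  have h1 := hH J hJ (by lia)
  have h2 := hH (insert j J) (Finset.insert_subset hj hJ) (by
    rw [Finset.card_insert_of_notMem hjJ]; lia)
  rw [Finset.inf_insert, inf_eq_right.2 hle, Finset.card_insert_of_notMem hjJ] at h2
  lia

theorem inf_comap {M : ℕ} (A : (Fin (M + 1) → K) →ₗ[K] (Fin (N + 1) → K)) (J : Finset ι) :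
    (J.inf fun i => (H i).comap A) = (J.inf H).comap A := by
  classical
  induction J using Finset.induction_on with
  | empty => simp
  | insert i J _ ih => rw [Finset.inf_insert, Finset.inf_insert, ih, Submodule.comap_inf]

/-- Restricting to one of the hyperplanes keeps the others in general position. -/
theorem InGeneralPositionOn.comap [DecidableEq ι] {H : ι → Flat K (N + 1)}
    (hH : InGeneralPositionOn S H) {j : ι} (hj : j ∈ S)
    {A : (Fin (N + 1) → K) →ₗ[K] (Fin (N + 1 + 1) → K)} (hA : Function.Injective A)
    (hr : LinearMap.range A = H j) :
    InGeneralPositionOn (S.erase j) fun i => (H i).comap A := by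
  intro J hJ hcard
  have hjJ : j ∉ J := fun h => Finset.notMem_erase j S (hJ h)
  have h := hH (insert j J) (Finset.insert_subset hj (hJ.trans (Finset.erase_subset j S))) (by
    rw [Finset.card_insert_of_notMem hjJ]; lia)
  rw [Finset.card_insert_of_notMem hjJ, Finset.inf_insert, ← hr, ← Submodule.map_comap_eq,
    ← (Submodule.equivMapOfInjective A hA _).finrank_eq] at h
  rw [inf_comap]
  lia

theorem exists_parametrization {L : Flat K (N + 1)} (h : Module.finrank K ↥L = N + 1) :
    ∃ A : (Fin (N + 1) → K) →ₗ[K] (Fin (N + 1 + 1) → K),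
      Function.Injective A ∧ LinearMap.range A = L := by
  have e : (Fin (N + 1) → K) ≃ₗ[K] ↥L :=
    LinearEquiv.ofFinrankEq _ _ (by rw [h, Module.finrank_fin_fun])
  refine ⟨L.subtype ∘ₗ e.toLinearMap, L.injective_subtype.comp e.injective, ?_⟩
  rw [LinearMap.range_comp, LinearEquiv.range, Submodule.map_top, Submodule.range_subtype]

variable [DecidableEq ι]

/-- In bounding orders of vanishing one may divide by the equations of the hyperplanes. -/
theorem sum_order_le_of_nonvanishing {a : ℕ} (haN : a + 1 ≤ N) (hH : InGeneralPositionOn S H)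
    (h : ∀ (d : ℕ) (f : CoordRing K N) (n : Finset ι → ℕ), f ≠ 0 → f.totalDegree ≤ d →
      (∀ J ∈ S.powersetCard (a + 1), f ∈ flatIdeal (J.inf H) ^ n J) →
      (∀ j ∈ S, f ∉ flatIdeal (H j)) →
      ∑ J ∈ S.powersetCard (a + 1), n J ≤ d * (S.card - 1).choose a)
    (d : ℕ) (f : CoordRing K N) (n : Finset ι → ℕ) (hf : f ≠ 0) (hd : f.totalDegree ≤ d)
    (hn : ∀ J ∈ S.powersetCard (a + 1), f ∈ flatIdeal (J.inf H) ^ n J) :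
    ∑ J ∈ S.powersetCard (a + 1), n J ≤ d * (S.card - 1).choose a := by
  induction d generalizing f n with
  | zero | succ d ih => ?_
  all_goals
    by_cases hv : ∀ j ∈ S, f ∉ flatIdeal (H j)
    · exact h _ f n hf hd hn hv
    push Not at hv
    obtain ⟨j, hj, hfj⟩ := hv
    obtain ⟨ψ, hψ, hker⟩ := exists_functional hH hj
    rw [hker] at hfj
    obtain ⟨g, rfl⟩ := exists_mul_eq_of_mem_flatIdeal_ker hfj
    have hψ' : linForm ψ ≠ 0 := left_ne_zero_of_mul hf
    have hg : g ≠ 0 := right_ne_zero_of_mul hf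
    rw [MvPolynomial.totalDegree_mul_of_isDomain hψ' hg,
      (isHomogeneous_linForm ψ).totalDegree hψ'] at hd
  · lia
  -- The equation of H_j vanishes to order one along the flats with j ∈ J and is not in the ideal of
  -- the others, so only the former orders drop. Truncation at n J = 0 is harmless, since n ≤ (n -
  -- 1) + 1.
  have key := ih g (fun J => if j ∈ J then n J - 1 else n J) hg (by lia) fun J hJ => by
    have hJ' := Finset.mem_powersetCard.1 hJ
    split_ifs with hjJ
    · have hle : ∀ v ∈ J.inf H, ψ v = 0 := fun v hv => by
        have : v ∈ H j := (Finset.inf_le hjJ : J.inf H ≤ H j) hv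
        rwa [hker] at this
      cases hnJ : n J with
      | zero => simp
      | succ k => exact mem_pow_of_linForm_mul_mem_pow hψ hle (hnJ ▸ hn J hJ)
    · refine mem_pow_of_mul_mem_pow (hn J hJ) fun hmem => ?_
      refine not_inf_le hH hJ'.1 (by lia) hj hjJ fun v hv => ?_
      rw [hker]
      exact linForm_mem_flatIdeal_iff.1 hmem v hv
  calc ∑ J ∈ S.powersetCard (a + 1), n J
      ≤ ∑ J ∈ S.powersetCard (a + 1),
          ((if j ∈ J then n J - 1 else n J) + if j ∈ J then 1 else 0) :=
        Finset.sum_le_sum fun J _ => by split_ifs <;> lia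
    _ ≤ d * (S.card - 1).choose a + (S.card - 1).choose a := by
        rw [Finset.sum_add_distrib, ← Finset.sum_filter _ (fun _ => 1), ← Finset.card_eq_sum_ones,
          card_powersetCard_filter_mem hj]
        exact Nat.add_le_add_right key _
    _ = (d + 1) * (S.card - 1).choose a := by ring

/-- The orders of vanishing of a polynomial along the `a + 1`-fold intersections of hyperplanes
in general position are bounded on average by its degree. -/
theorem sum_order_le (a : ℕ) : ∀ {N : ℕ} (S : Finset ι) (H : ι → Flat K N),
    a + 1 ≤ N → InGeneralPositionOn S H → ∀ (d : ℕ) (f : CoordRing K N) (n : Finset ι → ℕ),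
    f ≠ 0 → f.totalDegree ≤ d →
    (∀ J ∈ S.powersetCard (a + 1), f ∈ flatIdeal (J.inf H) ^ n J) →
    ∑ J ∈ S.powersetCard (a + 1), n J ≤ d * (S.card - 1).choose a := by
  induction a with
  | zero =>
    intro N S H haN hH
    -- The flats are now the hyperplanes themselves, so nonvanishing forces every order to be zero.
    refine sum_order_le_of_nonvanishing haN hH fun d f n hf hd hn hv => ?_
    refine (Finset.sum_eq_zero fun J hJ => ?_).trans_le (Nat.zero_le _)
    obtain ⟨hJS, hJ1⟩ := Finset.mem_powersetCard.1 hJ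
    obtain ⟨j, rfl⟩ := Finset.card_eq_one.1 hJ1
    by_contra hne
    have := Ideal.pow_le_self hne (hn _ hJ)
    rw [Finset.inf_singleton] at this
    exact hv j (by simpa using hJS) this
  | succ a ih =>
    intro N S H haN hH
    refine sum_order_le_of_nonvanishing haN hH fun d f n hf hd hn hv => ?_
    obtain hlt | hle := lt_or_ge S.card (a + 2)
    · rw [Finset.powersetCard_eq_empty.2 hlt]
      simp
    obtain ⟨N, rfl⟩ := Nat.exists_eq_add_of_le' (show 1 ≤ N by lia)
    -- Restrict to H_j, a projective space of dimension one less. The flat of J becomes that of J \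
    -- {j}, and f stays nonzero because it is not in the ideal of H_j.
    have key : ∀ j ∈ S, ∑ J ∈ S.powersetCard (a + 2) with j ∈ J, n J ≤
        d * (S.card - 2).choose a := by
      intro j hj
      rw [sum_powersetCard_filter_mem hj]
      have hfr := hH {j} (by simpa using hj) (by simp)
      rw [Finset.inf_singleton, Finset.card_singleton] at hfr
      obtain ⟨A, hA, hr⟩ := exists_parametrization (L := H j) (by lia)
      have := ih (S.erase j) (fun i => (H i).comap A) (by lia) (hH.comap hj hA hr) d
        (pullback A f) (fun J => n (insert j J))
        (fun h0 => hv j hj (mem_flatIdeal_of_pullback_eq_zero hr.ge h0))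
        ((totalDegree_pullback_le A f).trans hd) fun J hJ => by
          obtain ⟨hJS, hJc⟩ := Finset.mem_powersetCard.1 hJ
          have hjJ : j ∉ J := fun h => Finset.notMem_erase j S (hJS h)
          have hm := pullback_mem_pow (hn (insert j J) (Finset.mem_powersetCard.2
            ⟨Finset.insert_subset hj (hJS.trans (Finset.erase_subset j S)), by
              rw [Finset.card_insert_of_notMem hjJ, hJc]⟩)) A
          rwa [Finset.inf_insert, ← hr, Submodule.comap_inf, LinearMap.range_le_iff_comap.1 le_rfl, top_inf_eq,
            ← inf_comap] at hm
      rwa [Finset.card_erase_of_mem hj, Nat.sub_sub] at this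
    -- Summing over j counts each J exactly a + 2 times.
    refine Nat.le_of_mul_le_mul_left ?_ (Nat.succ_pos (a + 1))
    calc (a + 2) * ∑ J ∈ S.powersetCard (a + 2), n J
        ≤ S.card * (d * (S.card - 2).choose a) := by
          rw [← sum_sum_powersetCard_filter_mem, ← smul_eq_mul]
          exact Finset.sum_le_card_nsmul _ _ _ key
      _ = d * (S.card * (S.card - 2).choose a) := by ring
      _ ≤ d * ((a + 2) * (S.card - 1).choose (a + 1)) := Nat.mul_le_mul_left d (mul_choose_le hle)
      _ = (a + 2) * (d * (S.card - 1).choose (a + 1)) := by ring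

/-- A polynomial vanishing to order `n` along all `e`-fold intersections of `s` hyperplanes in
general position has degree at least `s n / e`. -/
theorem card_mul_le_mul_degree {e n d : ℕ} (he : 1 ≤ e) (heN : e ≤ N) (heS : e ≤ S.card)
    (hH : InGeneralPositionOn S H) {f : CoordRing K N} (hf : f ≠ 0) (hd : f.totalDegree ≤ d)
    (hn : ∀ J ∈ S.powersetCard e, f ∈ flatIdeal (J.inf H) ^ n) : S.card * n ≤ e * d := by
  obtain ⟨a, rfl⟩ := Nat.exists_eq_add_of_le' he
  have h := sum_order_le a S H heN hH d f (fun _ => n) hf hd hn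
  rw [Finset.sum_const, Finset.card_powersetCard, smul_eq_mul] at h
  have hc : S.card * (S.card - 1).choose a = S.card.choose (a + 1) * (a + 1) := by
    obtain ⟨t, ht⟩ := Nat.exists_eq_add_of_le' (show 1 ≤ S.card by lia)
    rw [ht]
    exact Nat.add_one_mul_choose_eq t a
  have hpos : 0 < (S.card - 1).choose a := Nat.choose_pos (by lia)
  refine Nat.le_of_mul_le_mul_right ?_ hpos
  calc S.card * n * (S.card - 1).choose a = n * (S.card * (S.card - 1).choose a) := by ring
    _ = (a + 1) * (S.card.choose (a + 1) * n) := by rw [hc]; ring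
    _ ≤ (a + 1) * (d * (S.card - 1).choose a) := Nat.mul_le_mul_left _ h
    _ = (a + 1) * d * (S.card - 1).choose a := by ring

end GeneralPosition

/-! ### Associated primes and symbolic powers of fat flats. -/

section SymbolicPower

theorem mem_associatedPrimes_quotient_iff {R : Type*} [CommRing R] [IsNoetherianRing R]
    {I P : Ideal R} : P ∈ associatedPrimes R (R ⧸ I) ↔
      P.IsPrime ∧ ∃ x, ∀ r, r ∈ P ↔ r * x ∈ I := by
  rw [AssociatedPrimes.mem_iff, IsAssociatedPrime, Submodule.isAssociatedPrime_iff]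
  refine and_congr_right fun _ => ?_
  rw [(Ideal.Quotient.mk_surjective (I := I)).exists]
  refine exists_congr fun x => ?_
  rw [SetLike.ext_iff]
  refine forall_congr' fun r => ?_
  rw [Submodule.mem_colon_singleton, Submodule.mem_bot,
    ← Ideal.Quotient.eq_zero_iff_mem (a := r * x), map_mul]
  rfl

theorem mem_symbolicPower_iff {R : Type*} [CommRing R] {I : Ideal R} {k : ℕ} {f : R} :
    f ∈ symbolicPower I k ↔
      ∀ P ∈ associatedPrimes R (R ⧸ I), ∃ u ∉ P, u * f ∈ I ^ k := by
  simp only [symbolicPower, Submodule.mem_iInf, Ideal.mem_comap]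
  refine ⟨fun h P hP => ?_, fun h P hP => ?_⟩
  · have := hP.isPrime
    have := h ⟨P, hP.isPrime⟩ hP
    rwa [IsLocalization.algebraMap_mem_map_algebraMap_iff P.primeCompl] at this
  · rw [IsLocalization.algebraMap_mem_map_algebraMap_iff P.asIdeal.primeCompl]
    exact h _ hP

variable {K : Type*} [Field K] {N : ℕ} {W : FlatSum K N}

theorem mem_fatIdeal_iff {f : CoordRing K N} :
    f ∈ fatIdeal W ↔ ∀ L ∈ W.support, f ∈ flatIdeal L ^ W L := by
  simp only [fatIdeal, Submodule.mem_iInf]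

theorem le_of_flatIdeal_le {L L' : Flat K N} (h : flatIdeal L' ≤ flatIdeal L) : L ≤ L' := by
  intro v hv
  by_contra hv'
  obtain ⟨ψ, hψ, hle⟩ := Submodule.exists_le_ker_of_notMem hv'
  exact hψ (linForm_mem_flatIdeal_iff.1 (h (linForm_mem_flatIdeal fun w hw => hle hw)) v hv)

/-- A prime containing a finite intersection of powers I(L')^m contains some I(L'), which would give
L ≤ L' against the antichain condition. Such a u is a unit at I(L) that absorbs the other
components. -/
theorem IsFatFlat.exists_notMem (hW : IsFatFlat W) {L : Flat K N} (hL : L ∈ W.support) :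
    ∃ u ∉ flatIdeal L, ∀ L' ∈ W.support, L' ≠ L → u ∈ flatIdeal L' ^ W L' := by
  classical
  have h : ¬ (W.support.erase L).inf (fun L' => flatIdeal L' ^ W L') ≤ flatIdeal L := by
    rw [(isPrime_flatIdeal L).inf_le']
    rintro ⟨L', hL', hle⟩
    rw [Finset.mem_erase] at hL'
    exact hW.antichain hL hL'.2 hL'.1.symm
      (le_of_flatIdeal_le ((isPrime_flatIdeal L).le_of_pow_le hle))
  obtain ⟨u, hu, huL⟩ := SetLike.not_le_iff_exists.1 h
  refine ⟨u, huL, fun L' hL' hne => ?_⟩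
  exact (Finset.inf_le (Finset.mem_erase.2 ⟨hne, hL'⟩) :
    (W.support.erase L).inf (fun L' => flatIdeal L' ^ W L') ≤ flatIdeal L' ^ W L') hu

/-- I(W) is an irredundant intersection of primary ideals with distinct radicals I(L). -/
theorem IsFatFlat.mem_associatedPrimes_iff (hW : IsFatFlat W) {P : Ideal (CoordRing K N)} :
    P ∈ associatedPrimes (CoordRing K N) (CoordRing K N ⧸ fatIdeal W) ↔
      ∃ L ∈ W.support, P = flatIdeal L := by
  rw [mem_associatedPrimes_quotient_iff]
  constructor
  · rintro ⟨hP, x, hx⟩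
    -- the colon ideal is the intersection of the colon ideals of the components
    have hle : W.support.inf (fun L => (flatIdeal L ^ W L).colon {x}) ≤ P := by
      intro r hr
      rw [Submodule.mem_finsetInf] at hr
      exact (hx r).2 (mem_fatIdeal_iff.2 fun L hL => by
        simpa [Submodule.mem_colon_singleton] using hr L hL)
    obtain ⟨L, hL, hLP⟩ := hP.inf_le'.1 hle
    have hxL : x ∉ flatIdeal L ^ W L := fun h => hP.ne_top <| (Ideal.eq_top_iff_one _).2 <|
      hLP <| by simpa [Submodule.mem_colon_singleton] using h
    refine ⟨L, hL, le_antisymm (fun r hr => ?_) (hP.le_of_pow_le (n := W L) fun r hr => hLP ?_)⟩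
    · by_contra hrL
      exact hxL (mem_pow_of_mul_mem_pow (mem_fatIdeal_iff.1 ((hx r).1 hr) L hL) hrL)
    · exact Submodule.mem_colon_singleton.2 (Ideal.mul_mem_right _ _ hr)
  · rintro ⟨L, hL, rfl⟩
    refine ⟨inferInstance, ?_⟩
    obtain ⟨u, huL, hu⟩ := hW.exists_notMem hL
    obtain ⟨ψ, hψ, hle⟩ :=
      Submodule.exists_le_ker_of_lt_top _ (lt_top_iff_ne_top.2 (hW.proper L hL).2)
    obtain ⟨n, hn⟩ := Nat.exists_eq_succ_of_ne_zero (Finsupp.mem_support_iff.1 hL)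
    have hmem := linForm_mem_flatIdeal fun v hv => hle hv
    -- With n = W(L) - 1, this element lies in every other component and misses I(L)^{W(L)} by
    -- exactly one order.
    refine ⟨u * linForm ψ ^ n, fun r => ⟨fun hr => mem_fatIdeal_iff.2 fun L' hL' => ?_,
      fun hr => ?_⟩⟩
    · by_cases hne : L' = L
      · subst hne
        rw [hn, Nat.succ_eq_add_one, pow_succ', mul_left_comm]
        exact Ideal.mul_mem_left _ _ (Ideal.mul_mem_mul hr (Ideal.pow_mem_pow hmem n))
      · exact Ideal.mul_mem_left _ _ (Ideal.mul_mem_right _ _ (hu L' hL' hne))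
    · by_contra hrL
      have h1 := mem_pow_of_mul_mem_pow (mem_fatIdeal_iff.1 hr L hL) hrL
      rw [hn] at h1
      exact linForm_pow_notMem hψ (fun v hv => hle hv) n (mem_pow_of_mul_mem_pow h1 huL)

/-- Localizing at I(L) leaves only the component I(L)^{W(L)}, whose powers are primary and hence
equal their contractions. -/
theorem IsFatFlat.mem_symbolicPower_iff (hW : IsFatFlat W) {k : ℕ} {f : CoordRing K N} :
    f ∈ symbolicPower (fatIdeal W) k ↔ ∀ L ∈ W.support, f ∈ flatIdeal L ^ (W L * k) := by
  rw [FatFlats.mem_symbolicPower_iff]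
  constructor
  · intro h L hL
    obtain ⟨u, huL, hu⟩ := h _ (hW.mem_associatedPrimes_iff.2 ⟨L, hL, rfl⟩)
    refine mem_pow_of_mul_mem_pow ?_ huL
    rw [pow_mul]
    exact Ideal.pow_right_mono (fun g hg => mem_fatIdeal_iff.1 hg L hL) k hu
  · intro h P hP
    obtain ⟨L, hL, rfl⟩ := hW.mem_associatedPrimes_iff.1 hP
    obtain ⟨u, huL, hu⟩ := hW.exists_notMem hL
    refine ⟨u ^ k, fun hk => huL ((isPrime_flatIdeal L).mem_of_pow_mem k hk), ?_⟩
    have hle : Ideal.span {u} * flatIdeal L ^ W L ≤ fatIdeal W := by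
      rw [Ideal.span_singleton_mul_le_iff]
      refine fun g hg => mem_fatIdeal_iff.2 fun L' hL' => ?_
      by_cases hne : L' = L
      · subst hne
        exact Ideal.mul_mem_left _ _ hg
      · exact Ideal.mul_mem_right _ _ (hu L' hL' hne)
    refine Ideal.pow_right_mono hle k ?_
    rw [mul_pow, ← pow_mul, Ideal.span_singleton_pow]
    exact Ideal.mul_mem_mul (Ideal.mem_span_singleton_self _) (h L hL)

end SymbolicPower

/-! ### Star configurations and their Waldschmidt constants. -/

section Star

variable {K : Type*} [Field K] {N s : ℕ} {H : Fin s → Flat K N}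

theorem InGeneralPosition.on_univ (hH : InGeneralPosition H) :
    InGeneralPositionOn Finset.univ H := fun J _ => hH J

theorem InGeneralPosition.eq_of_inf_le (hH : InGeneralPosition H) {J J' : Finset (Fin s)}
    (hJ : J.card ≤ N) (hcard : J.card ≤ J'.card) (h : J.inf H ≤ J'.inf H) : J' = J := by
  refine Finset.eq_of_subset_of_card_le (fun j hj => ?_) hcard
  by_contra hjJ
  exact not_inf_le hH.on_univ (Finset.subset_univ J) hJ (Finset.mem_univ j) hjJ
    (h.trans (Finset.inf_le hj))

theorem mem_support_star {e : ℕ} {L : Flat K N} :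
    L ∈ (star H e).support ↔ ∃ J : Finset (Fin s), J.card = e ∧ J.inf H = L := by
  classical
  rw [Finsupp.mem_support_iff, star, Finsupp.finsetSum_apply, Ne, Finset.sum_eq_zero_iff]
  simp [Finsupp.single_apply]

/-- Different index sets of this size cut out different flats, so no multiplicities add up. -/
theorem star_inf (hH : InGeneralPosition H) {J : Finset (Fin s)} (hJ : J.card ≤ N) :
    star H J.card (J.inf H) = 1 := by
  classical
  rw [star, Finsupp.finsetSum_apply, Finset.sum_eq_single J]
  · simp
  · intro J' hJ' hne
    refine Finsupp.single_eq_of_ne fun h => hne ?_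
    exact hH.eq_of_inf_le hJ (Finset.mem_powersetCard.1 hJ').2.ge h.le
  · intro h
    exact absurd (Finset.mem_powersetCard.2 ⟨Finset.subset_univ J, rfl⟩) h

theorem mem_support_add_smul_star {W' : FlatSum K N} {e m : ℕ} (hm : 1 ≤ m) {L : Flat K N} :
    L ∈ (W' + m • star H e).support ↔ L ∈ W'.support ∨ L ∈ (star H e).support := by
  simp only [Finsupp.mem_support_iff, Finsupp.add_apply, Finsupp.smul_apply, smul_eq_mul, Ne,
    Nat.add_eq_zero_iff, mul_eq_zero]
  have : m ≠ 0 := by lia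
  tauto

theorem isAdmissible_zero (hH : InGeneralPosition H) {e m : ℕ} (heN : e ≤ N) (hm : 1 ≤ m) :
    IsAdmissible H e m 0 where
  codim := by simp
  subset_union := by simp
  disjoint_star := by simp
  mult_le := by simp
  antichain := by
    intro L hL L' hL' hne hle
    rw [Finset.mem_coe, mem_support_add_smul_star hm] at hL hL'
    obtain ⟨J, hJ, rfl⟩ := mem_support_star.1 (hL.resolve_left (by simp))
    obtain ⟨J', hJ', rfl⟩ := mem_support_star.1 (hL'.resolve_left (by simp))
    exact hne (by rw [hH.eq_of_inf_le (by lia) (by lia) hle])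

variable {W' : FlatSum K N} {e m : ℕ}

theorem IsAdmissible.isFatFlat (hH : InGeneralPosition H) (he : 1 ≤ e) (heN : e ≤ N)
    (hes : e ≤ s) (hm : 1 ≤ m) (hW : IsAdmissible H e m W') : IsFatFlat (W' + m • star H e) where
  nonempty := by
    obtain ⟨J, -, hJ⟩ := Finset.exists_subset_card_eq
      (show e ≤ (Finset.univ : Finset (Fin s)).card by simpa using hes)
    exact ⟨J.inf H, (mem_support_add_smul_star hm).2 (.inr (mem_support_star.2 ⟨J, hJ, rfl⟩))⟩
  proper := by
    intro L hL
    have key : ∃ i, 1 ≤ i ∧ i ≤ N ∧ Module.finrank K ↥L + i = N + 1 := by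
      obtain h | h := (mem_support_add_smul_star hm).1 hL
      · obtain ⟨i, h2, hi⟩ := hW.codim L h
        exact ⟨i, by lia, hi⟩
      · obtain ⟨J, hJ, rfl⟩ := mem_support_star.1 h
        exact ⟨e, he, heN, by rw [← hJ]; exact hH J (by lia)⟩
    obtain ⟨i, h1, hi, hfr⟩ := key
    constructor <;> rintro rfl
    · rw [finrank_bot] at hfr
      lia
    · rw [finrank_top, Module.finrank_fin_fun] at hfr
      lia
  antichain := hW.antichain

theorem IsAdmissible.apply_inf (hH : InGeneralPosition H) (heN : e ≤ N)
    (hW : IsAdmissible H e m W') {J : Finset (Fin s)} (hJ : J.card = e) :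
    (W' + m • star H e) (J.inf H) = m := by
  have h0 : W' (J.inf H) = 0 := Finsupp.notMem_support_iff.1
    (Finset.disjoint_right.1 hW.disjoint_star (mem_support_star.2 ⟨J, hJ, rfl⟩))
  subst hJ
  simp [h0, star_inf hH heN]

theorem IsAdmissible.apply_of_mem_support (hW : IsAdmissible H e m W') {M : Flat K N}
    (hM : M ∈ W'.support) : (W' + m • star H e) M ≤ m / e := by
  have h0 : star H e M = 0 :=
    Finsupp.notMem_support_iff.1 (Finset.disjoint_left.1 hW.disjoint_star hM)
  simpa [h0] using hW.mult_le M

/-- A vector space over an infinite field is not a finite union of proper subspaces. -/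
theorem exists_le_of_subset_iUnion [Infinite K] {M : Flat K N}
    (h : (M : Set (Fin (N + 1) → K)) ⊆ ⋃ j, (H j : Set (Fin (N + 1) → K))) : ∃ j, M ≤ H j := by
  have : ⋃ j, (((H j).comap M.subtype : Submodule K ↥M) : Set ↥M) = Set.univ := by
    refine Set.eq_univ_of_forall fun v => ?_
    simpa using h v.2
  obtain ⟨j, hj⟩ := Subspace.exists_eq_top_of_iUnion_eq_univ this
  exact ⟨j, by simpa using hj⟩

/-- The powers of the product of the equations of the hyperplanes lie in the symbolic powers. -/
theorem IsAdmissible.exists_homogeneous_mem [Infinite K] (hH : InGeneralPosition H) (he : 1 ≤ e)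
    (heN : e ≤ N) (hes : e ≤ s) (hm : 1 ≤ m) (hW : IsAdmissible H e m W') (k : ℕ) :
    ∃ f ∈ symbolicPower (fatIdeal (W' + m • star H e)) k,
      f ≠ 0 ∧ f.IsHomogeneous (s * (m * k / e + 1)) := by
  choose ψ hψ hker using fun j => exists_functional hH.on_univ (Finset.mem_univ j)
  -- The +1 ensures e·q ≥ mk despite rounding down; it adds only s to the degree, which is
  -- negligible after division by k.
  set q := m * k / e + 1 with hq
  have hmem : ∀ {L : Flat K N} {j}, L ≤ H j → linForm (ψ j) ∈ flatIdeal L := fun {L j} hL =>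
    linForm_mem_flatIdeal fun v hv => by
      have := hL hv
      rwa [hker] at this
  refine ⟨∏ j, linForm (ψ j) ^ q, (hW.isFatFlat hH he heN hes hm).mem_symbolicPower_iff.2 ?_,
    ?_, ?_⟩
  · intro L hL
    obtain h | h := (mem_support_add_smul_star hm).1 hL
    · obtain ⟨j, hj⟩ := exists_le_of_subset_iUnion (hW.subset_union L h)
      refine Ideal.mem_of_dvd _ (Finset.dvd_prod_of_mem _ (Finset.mem_univ j)) ?_
      refine Ideal.pow_le_pow_right ?_ (Ideal.pow_mem_pow (hmem hj) q)
      calc _ ≤ m / e * k := Nat.mul_le_mul_right k (hW.apply_of_mem_support h)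
        _ ≤ m * k / e := by
          rw [Nat.le_div_iff_mul_le (by lia), mul_right_comm]
          exact Nat.mul_le_mul_right k (Nat.div_mul_le_self m e)
        _ ≤ q := Nat.le_succ _
    -- The e hyperplanes through the flat each contribute order q.
    · obtain ⟨J, hJ, rfl⟩ := mem_support_star.1 h
      rw [hW.apply_inf hH heN hJ]
      refine Ideal.mem_of_dvd _ (Finset.prod_dvd_prod_of_subset J _ _ (Finset.subset_univ J)) ?_
      have h1 : ∏ j ∈ J, linForm (ψ j) ^ q ∈ flatIdeal (J.inf H) ^ (e * q) := by
        rw [Finset.prod_pow, pow_mul, ← hJ]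
        refine Ideal.pow_mem_pow ?_ q
        rw [← Finset.prod_const]
        exact Ideal.prod_mem_prod fun j hj => hmem (Finset.inf_le hj)
      refine Ideal.pow_le_pow_right ?_ h1
      exact (Nat.lt_mul_div_succ (m * k) (by lia)).le
  · exact Finset.prod_ne_zero_iff.2 fun j _ => pow_ne_zero _ fun h0 =>
      hψ j (linForm_injective (by rw [h0, map_zero]))
  · have := MvPolynomial.IsHomogeneous.prod Finset.univ (fun j => linForm (ψ j) ^ q)
      (fun _ => 1 * q) fun j _ => (isHomogeneous_linForm (ψ j)).pow q
    simpa using this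

/-- The Waldschmidt constant of `W' + m S_N(e,s)` is `s m / e`. -/
theorem IsAdmissible.hasWaldschmidtConstant [Infinite K] (hH : InGeneralPosition H) (he : 1 ≤ e)
    (heN : e ≤ N) (hes : e ≤ s) (hm : 1 ≤ m) (hW : IsAdmissible H e m W') :
    HasWaldschmidtConstant (fatIdeal (W' + m • star H e)) ((s * m : ℕ) / e : ℝ) := by
  have he' : (0 : ℝ) < e := by exact_mod_cast he
  set α := fun k => initialDegree (symbolicPower (fatIdeal (W' + m • star H e)) k) with hα
  have hupper : ∀ k, α k ≤ s * (m * k / e + 1) := fun k =>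
    Nat.sInf_le (hW.exists_homogeneous_mem hH he heN hes hm k)
  -- Only the flats of the star are used here. Nonemptiness of the set of degrees matters, since the
  -- infimum of the empty set would be 0.
  have hlower : ∀ k, s * (m * k) ≤ e * α k := by
    intro k
    obtain ⟨f, hf, hf0, hhom⟩ := Nat.sInf_mem
      (⟨_, hW.exists_homogeneous_mem hH he heN hes hm k⟩ : Set.Nonempty {t : ℕ | ∃ f ∈
        symbolicPower (fatIdeal (W' + m • star H e)) k, f ≠ 0 ∧ f.IsHomogeneous t})
    have := card_mul_le_mul_degree (S := Finset.univ) (n := m * k) he heN (by simpa using hes)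
      hH.on_univ hf0 hhom.totalDegree_le fun J hJ => by
        have hJ' := (Finset.mem_powersetCard.1 hJ).2
        rw [← hW.apply_inf hH heN hJ']
        exact (hW.isFatFlat hH he heN hes hm).mem_symbolicPower_iff.1 hf _
          ((mem_support_add_smul_star hm).2 (.inr (mem_support_star.2 ⟨J, hJ', rfl⟩)))
    rwa [Finset.card_univ, Fintype.card_fin] at this
  have hlim : Tendsto (fun k : ℕ => ((s * m : ℕ) / e : ℝ) + (s : ℝ) / k) atTop
      (𝓝 ((s * m : ℕ) / e : ℝ)) := by
    simpa using tendsto_const_nhds.add (tendsto_const_div_atTop_nhds_zero_nat (s : ℝ))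
  refine tendsto_of_tendsto_of_tendsto_of_le_of_le' tendsto_const_nhds hlim ?_ ?_ <;>
    filter_upwards [eventually_gt_atTop 0] with k hk <;>
    have hk' : (0 : ℝ) < k := by exact_mod_cast hk
  · rw [div_le_div_iff₀ he' hk']
    have := hlower k
    rw [← mul_assoc, mul_comm e] at this
    exact_mod_cast this
  · have h1 : e * α k ≤ s * (m * k) + s * e := by
      calc e * α k ≤ e * (s * (m * k / e + 1)) := Nat.mul_le_mul_left e (hupper k)
        _ = s * (m * k / e * e) + s * e := by ring
        _ ≤ s * (m * k) + s * e := 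
          Nat.add_le_add_right (Nat.mul_le_mul_left s (Nat.div_mul_le_self _ _)) _
    have h2 : (e * α k : ℝ) ≤ s * (m * k) + s * e := by exact_mod_cast h1
    rw [div_add_div _ _ he'.ne' hk'.ne', div_le_div_iff₀ hk' (mul_pos he' hk')]
    push_cast
    nlinarith

end Star

/-! ### Existence of hyperplanes in general position. -/

section Existence

/-- The functional on `K^(N+1)` that evaluates the polynomial with given coefficients at `t`. -/
def evalFunctional {K : Type*} [Field K] (N : ℕ) (t : K) : Module.Dual K (Fin (N + 1) → K) :=
  ∑ i : Fin (N + 1), t ^ (i : ℕ) • LinearMap.proj i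

/-- Over an infinite field there are hyperplanes in general position: the osculating ones of a
rational normal curve, say. -/
theorem exists_inGeneralPosition (K : Type*) [Field K] [Infinite K] (N s : ℕ) :
    ∃ H : Fin s → Flat K N, InGeneralPosition H := by
  let t : Fin s ↪ K := (Fin.valEmbedding).trans (Infinite.natEmbedding K)
  refine ⟨fun j => LinearMap.ker (evalFunctional N (t j)), fun J hJ => ?_⟩
  let Φ : (Fin (N + 1) → K) →ₗ[K] (J → K) := LinearMap.pi fun j => evalFunctional N (t j)
  have hker : LinearMap.ker Φ = J.inf fun j => LinearMap.ker (evalFunctional N (t j)) := by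
    rw [LinearMap.ker_pi, Finset.inf_eq_iInf, iInf_subtype]
  -- Lagrange interpolation: values at |J| ≤ N + 1 distinct nodes are attained by a polynomial of
  -- degree at most N. Rank-nullity then gives codimension |J|.
  have hsurj : Function.Surjective Φ := by
    classical
    intro y
    let y' : Fin s → K := fun j => if h : j ∈ J then y ⟨j, h⟩ else 0
    have hdeg := Lagrange.degree_interpolate_lt y' (s := J) t.injective.injOn
    refine ⟨fun i => (Lagrange.interpolate J t y').coeff i, funext fun j => ?_⟩
    have hev := Lagrange.eval_interpolate_at_node y' (s := J) t.injective.injOn j.2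
    have hlt : (Lagrange.interpolate J t y').natDegree < N + 1 := by
      by_cases h0 : Lagrange.interpolate J t y' = 0
      · simp [h0]
      · have := (Polynomial.natDegree_lt_iff_degree_lt h0).2 hdeg
        lia
    rw [Polynomial.eval_eq_sum_range' hlt, Finset.sum_range] at hev
    simp only [Φ, LinearMap.pi_apply, evalFunctional, LinearMap.sum_apply, LinearMap.smul_apply,
      LinearMap.proj_apply, smul_eq_mul]
    simp_rw [mul_comm (t j ^ _)]
    rw [hev]
    simp [y']
  have := LinearMap.finrank_range_add_finrank_ker Φ
  rw [LinearMap.range_eq_top.2 hsurj, finrank_top, Module.finrank_fintype_fun_eq_card,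
    Module.finrank_fin_fun, Fintype.card_coe, hker] at this
  lia

end Existence

end FatFlats

end

theorem mainTheorem4 (K : Type*) [Field K] [Infinite K] (a b N : ℕ)
    (ha : 1 ≤ a) (hab : a < b) (hN : a ≤ N) :
    -- some fat flat subscheme of `ℙ^N` has Waldschmidt constant `b / a`
    (∃ W : FatFlats.FlatSum K N, FatFlats.IsFatFlat W ∧
      FatFlats.HasWaldschmidtConstant (FatFlats.fatIdeal W) ((b : ℝ) / a)) ∧
    -- for `b = s m` with `a ≤ s`, each `W' + m S_N(a,s)` is one, and such schemes exist
    (∀ s m : ℕ, b = s * m → a ≤ s →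
      (∃ H : Fin s → FatFlats.Flat K N, FatFlats.InGeneralPosition H ∧
        ∃ W' : FatFlats.FlatSum K N, FatFlats.IsAdmissible H a m W') ∧
      ∀ H : Fin s → FatFlats.Flat K N, FatFlats.InGeneralPosition H →
        ∀ W' : FatFlats.FlatSum K N, FatFlats.IsAdmissible H a m W' →
          FatFlats.IsFatFlat (W' + m • FatFlats.star H a) ∧
          FatFlats.HasWaldschmidtConstant
            (FatFlats.fatIdeal (W' + m • FatFlats.star H a)) ((b : ℝ) / a)) ∧
    -- each star configuration `S_N(a,b)` is one, and such configurations exist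
    ((∃ H : Fin b → FatFlats.Flat K N, FatFlats.InGeneralPosition H) ∧
      ∀ H : Fin b → FatFlats.Flat K N, FatFlats.InGeneralPosition H →
        FatFlats.IsFatFlat (FatFlats.star H a) ∧
        FatFlats.HasWaldschmidtConstant
          (FatFlats.fatIdeal (FatFlats.star H a)) ((b : ℝ) / a)) := by
  have part2 : ∀ s m : ℕ, b = s * m → a ≤ s →
      (∃ H : Fin s → FatFlats.Flat K N, FatFlats.InGeneralPosition H ∧
        ∃ W' : FatFlats.FlatSum K N, FatFlats.IsAdmissible H a m W') ∧
      ∀ H : Fin s → FatFlats.Flat K N, FatFlats.InGeneralPosition H →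
        ∀ W' : FatFlats.FlatSum K N, FatFlats.IsAdmissible H a m W' →
          FatFlats.IsFatFlat (W' + m • FatFlats.star H a) ∧
          FatFlats.HasWaldschmidtConstant
            (FatFlats.fatIdeal (W' + m • FatFlats.star H a)) ((b : ℝ) / a) := by
    rintro s m rfl has
    have hm : 1 ≤ m := by
      by_contra! h
      rw [Nat.lt_one_iff.1 h] at hab
      lia
    obtain ⟨H, hH⟩ := FatFlats.exists_inGeneralPosition K N s
    refine ⟨⟨H, hH, 0, FatFlats.isAdmissible_zero hH hN hm⟩, fun H hH W' hW => ⟨?_, ?_⟩⟩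
    · exact hW.isFatFlat hH ha hN has hm
    · exact hW.hasWaldschmidtConstant hH ha hN has hm
  have part3 : ∀ H : Fin b → FatFlats.Flat K N, FatFlats.InGeneralPosition H →
      FatFlats.IsFatFlat (FatFlats.star H a) ∧
      FatFlats.HasWaldschmidtConstant (FatFlats.fatIdeal (FatFlats.star H a)) ((b : ℝ) / a) := by
    intro H hH
    -- A star configuration is the case s = b, m = 1, W' = 0.
    have := (part2 b 1 (mul_one b).symm hab.le).2 H hH 0
      (FatFlats.isAdmissible_zero hH hN le_rfl)
    rwa [zero_add, one_smul] at this
  obtain ⟨H, hH⟩ := FatFlats.exists_inGeneralPosition K N b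
  exact ⟨⟨_, part3 H hH⟩, part2, ⟨H, hH⟩, part3⟩
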